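/- Consider $n\ge 2$ agents and $l$ perfectly divisible goods with a fixed social endowment $\Omega=(\Omega^1,\dots,\Omega^l)\in\mathbb{R}^l_+$ in which at least two goods are available in positive amounts. Let $X=\prod_{\ell=1}^{l}[0,\Omega^\ell]$ be the consumption set and let $Z=\{(x_1,\dots,x_n)\in X^n:\sum_{i=1}^n x_i=\Omega\}$ be the set of feasible allocations. A preference is a complete, transitive, continuous and strictly convex binary relation $R_0$ on $X$, with strict part $P_0$ and indifference part $I_0$. It is multidimensional single-peaked if there is $p\in X$ such that, for all $x,\tilde x\in X$ with $x\ne\tilde x$, $x\,P_0\,\tilde x$ whenever $x$ is between $p$ and $\tilde x$, that is, whenever for each good $\ell$ either $p^\ell\le x^\ell\le\tilde x^\ell$ or $p^\ell\ge x^\ell\ge\tilde x^\ell$. Let $\mathcal{R}$ be the set of all multidimensional single-peaked preferences on $X$. Then no rule $\varphi:\mathcal{R}^n\to Z$ satisfies all three of the following properties: (a) strategy-proofness: $\varphi_i(R)\,R_i\,\varphi_i(R_i',R_{-i})$ for each $R\in\mathcal{R}^n$, each agent $i$ and each $R_i'\in\mathcal{R}$; (b) efficiency: for each $R\in\mathcal{R}^n$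 there is no $x'\in Z$ such that $x_i'\,R_i\,\varphi_i(R)$ for every agent $i$ and $x_j'\,P_j\,\varphi_j(R)$ for some agent $j$; (c) equal treatment: for each $R\in\mathcal{R}^n$ and all agents $i,j$, $R_i=R_j$ implies $\varphi_i(R)\,I_i\,\varphi_j(R)$. -/

import Mathlib

/-- The consumption set `X = ∏ ℓ, [0, Ω ℓ]` of an economy with `l` goods and social
endowment `Ω`. -/
abbrev Bundle {l : ℕ} (Ω : Fin l → ℝ) : Type := Set.Icc (0 : Fin l → ℝ) Ω

/-- A preference relation on the consumption set: complete, transitive, continuous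
(closed upper and lower contour sets) and strictly convex. `R.rel x y` means that `x` is at
least as good as `y`. -/
@[ext]
structure Preference {l : ℕ} (Ω : Fin l → ℝ) where
  rel : Bundle Ω → Bundle Ω → Prop
  complete : ∀ x y, rel x y ∨ rel y x
  transitive : ∀ x y z, rel x y → rel y z → rel x z
  closed_upper : ∀ x, IsClosed {y | rel y x}
  closed_lower : ∀ x, IsClosed {y | rel x y}
  strictly_convex : ∀ (x y z : Bundle Ω) (t : ℝ), 0 < t → t < 1 → x ≠ y → rel x y →
    (z : Fin l → ℝ) = t • (x : Fin l → ℝ) + (1 - t) • (y : Fin l → ℝ) →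
    rel z y ∧ ¬ rel y z

/-- The strict relation `P` associated with a preference. -/
def Preference.strict {l : ℕ} {Ω : Fin l → ℝ} (R : Preference Ω) (x y : Bundle Ω) : Prop :=
  R.rel x y ∧ ¬ R.rel y x

/-- The indifference relation `I` associated with a preference. -/
def Preference.indiff {l : ℕ} {Ω : Fin l → ℝ} (R : Preference Ω) (x y : Bundle Ω) : Prop :=
  R.rel x y ∧ R.rel y x

/-- `IsBetween a x b`: the bundle `x` is between `a` and `b`, good by good. -/
def IsBetween {l : ℕ} {Ω : Fin l → ℝ} (a x b : Bundle Ω) : Prop :=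
  ∀ ℓ : Fin l, (a.1 ℓ ≤ x.1 ℓ ∧ x.1 ℓ ≤ b.1 ℓ) ∨ (a.1 ℓ ≥ x.1 ℓ ∧ x.1 ℓ ≥ b.1 ℓ)

/-- A preference is multidimensional single-peaked if for some bundle `p` every bundle `x`
between `p` and a bundle `y ≠ x` is strictly preferred to `y`. (Taking `x = p` shows that `p`
is then the unique most preferred bundle.) -/
def Preference.IsMultidimSinglePeaked {l : ℕ} {Ω : Fin l → ℝ} (R : Preference Ω) : Prop :=
  ∃ p : Bundle Ω, ∀ x y : Bundle Ω, x ≠ y → IsBetween p x y → R.strict x y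

/-- The domain of all multidimensional single-peaked preferences. -/
def multidimSinglePeaked {l : ℕ} (Ω : Fin l → ℝ) : Set (Preference Ω) :=
  {R | R.IsMultidimSinglePeaked}

/-- The set `Z` of feasible allocations among `n` agents: the endowment is fully allocated. -/
abbrev Allocation {l : ℕ} (n : ℕ) (Ω : Fin l → ℝ) : Type :=
  {x : Fin n → Bundle Ω // ∑ i, (x i : Fin l → ℝ) = Ω}

/-- An allocation rule for `n` agents on a domain `D` of preferences. -/
abbrev Rule {l : ℕ} {Ω : Fin l → ℝ} (n : ℕ) (D : Set (Preference Ω)) : Type :=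
  (Fin n → D) → Allocation n Ω

/-- No agent ever gains by reporting a preference other than the true one. -/
def Rule.StrategyProof {l n : ℕ} {Ω : Fin l → ℝ} {D : Set (Preference Ω)}
    (φ : Rule n D) : Prop :=
  ∀ (R : Fin n → D) (i : Fin n) (R' : D),
    (R i).1.rel ((φ R).1 i) ((φ (Function.update R i R')).1 i)

/-- No feasible allocation Pareto dominates the allocation selected by the rule. -/
def Rule.Efficient {l n : ℕ} {Ω : Fin l → ℝ} {D : Set (Preference Ω)}
    (φ : Rule n D) : Prop :=
  ∀ R : Fin n → D, ¬ ∃ x : Allocation n Ω,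
    (∀ i, (R i).1.rel (x.1 i) ((φ R).1 i)) ∧ ∃ j, (R j).1.strict (x.1 j) ((φ R).1 j)

/-- Agents with the same preference receive indifferent bundles. -/
def Rule.EqualTreatment {l n : ℕ} {Ω : Fin l → ℝ} {D : Set (Preference Ω)}
    (φ : Rule n D) : Prop :=
  ∀ (R : Fin n → D) (i j : Fin n), R i = R j →
    (R i).1.indiff ((φ R).1 i) ((φ R).1 j)

open scoped RealInnerProductSpace

/-! Euclidean preferences already produce the contradiction. Let two agents have peaks p and q with
p + q ≥ Ω, and let the others want nothing. Efficiency puts the first agent on the segment from p to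
c = Ω - q, which is q seen from the other corner of the Edgeworth box
(`Rule.Efficient.twoAgentProfile`).

Fix q at distance ρ from Ω/2 and let p range over a sector with apex c. At p = q, equal treatment
puts the first agent at distance ρ from c. Strategy-proofness carries this value to closer peaks on
the same ray, and then to all other directions of the sector: misreporting the direction by a small
angle changes the squared distance to the peak only to second order, so that distance cannot vary
(`dist_apex_eq_of_nonmanipulable`). Hence the second agent stays at distance ρ from q
(`dist_peak_eq`).

Now put q and p at angles 0 and π/3 on the circle of radius ρ around Ω/2. The argument applies with
either agent in either role, so both are at distance ρ from their peaks. But the two distances add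
up to dist p c = √3 ρ < 2ρ. -/

/-- A bundle seen as a point of Euclidean space. -/
noncomputable def Bundle.vec {l : ℕ} {Ω : Fin l → ℝ} (x : Bundle Ω) : EuclideanSpace ℝ (Fin l) :=
  WithLp.toLp 2 x.1

/-! ### Euclidean preferences -/

section EuclideanPreferences

variable {l : ℕ} {Ω : Fin l → ℝ}

lemma Bundle.vec_apply (x : Bundle Ω) (ℓ : Fin l) : x.vec ℓ = x.1 ℓ := rfl

lemma Bundle.vec_injective : Function.Injective (Bundle.vec (Ω := Ω)) := fun _ _ h =>
  Subtype.ext (WithLp.toLp_injective 2 h)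

lemma Bundle.continuous_vec : Continuous (Bundle.vec (Ω := Ω)) :=
  (PiLp.continuous_toLp 2 _).comp continuous_subtype_val

lemma dist_convexCombination_lt {E : Type*} [NormedAddCommGroup E] [InnerProductSpace ℝ E]
    {x y p : E} {t : ℝ} (h0 : 0 < t) (h1 : t < 1) (hne : x ≠ y) (h : dist x p ≤ dist y p) :
    dist (t • x + (1 - t) • y) p < dist y p := by
  have hy : y ∈ Metric.closedBall p (dist y p) := Metric.mem_closedBall.2 le_rfl
  have hx : x ∈ Metric.closedBall p (dist y p) := h
  have := combo_mem_ball_of_ne hx hy hne h0 (by linarith : 0 < 1 - t) (by ring)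
  exact this

/-- The preference ranking bundles by their Euclidean distance to the peak `p`. -/
noncomputable def euclideanPreference (p : Bundle Ω) : Preference Ω where
  rel x y := dist x.vec p.vec ≤ dist y.vec p.vec
  complete x y := le_total _ _
  transitive x y z := le_trans
  closed_upper x :=
    isClosed_le (Bundle.continuous_vec.dist continuous_const) continuous_const
  closed_lower x :=
    isClosed_le continuous_const (Bundle.continuous_vec.dist continuous_const)
  strictly_convex x y z t h0 h1 hne h hz := by
    have hz' : z.vec = t • x.vec + (1 - t) • y.vec := by
      ext ℓ
      simpa [Bundle.vec_apply] using congrFun hz ℓ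
    have := dist_convexCombination_lt h0 h1 (Bundle.vec_injective.ne hne) h
    rw [← hz'] at this
    exact ⟨this.le, this.not_ge⟩

lemma euclideanPreference_rel {p x y : Bundle Ω} :
    (euclideanPreference p).rel x y ↔ dist x.vec p.vec ≤ dist y.vec p.vec := Iff.rfl

lemma euclideanPreference_strict {p x y : Bundle Ω} :
    (euclideanPreference p).strict x y ↔ dist x.vec p.vec < dist y.vec p.vec := by
  simp only [Preference.strict, euclideanPreference_rel, not_le]
  exact ⟨fun h => h.2, fun h => ⟨h.le, h⟩⟩

lemma euclideanPreference_isMultidimSinglePeaked (p : Bundle Ω) :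
    (euclideanPreference p).IsMultidimSinglePeaked := by
  refine ⟨p, fun x y hne hb => euclideanPreference_strict.2 ?_⟩
  rw [EuclideanSpace.dist_eq, EuclideanSpace.dist_eq]
  obtain ⟨m, hm⟩ : ∃ m, x.1 m ≠ y.1 m := by
    by_contra! h
    exact hne (Subtype.ext (funext h))
  refine Real.sqrt_lt_sqrt (Finset.sum_nonneg fun _ _ => sq_nonneg _)
    (Finset.sum_lt_sum (fun ℓ _ => ?_) ⟨m, Finset.mem_univ _, ?_⟩)
  · simp only [Real.dist_eq, sq_abs, Bundle.vec_apply]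
    rcases hb ℓ with h | h <;> nlinarith [h.1, h.2]
  · simp only [Real.dist_eq, sq_abs, Bundle.vec_apply]
    rcases hb m with h | h
    · have : x.1 m < y.1 m := lt_of_le_of_ne h.2 hm
      nlinarith [h.1]
    · have : y.1 m < x.1 m := lt_of_le_of_ne h.2 hm.symm
      nlinarith [h.1]

/-- The Euclidean preference with peak `p` as an element of the domain. -/
noncomputable def euclideanReport (p : Bundle Ω) : multidimSinglePeaked Ω :=
  ⟨euclideanPreference p, euclideanPreference_isMultidimSinglePeaked p⟩

end EuclideanPreferences

/-! ### Efficiency with two active agents -/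

section TwoActiveAgents

variable {l n : ℕ} {Ω : Fin l → ℝ}

/-- The bundle containing nothing. -/
def zeroBundle (hΩ : ∀ ℓ, 0 ≤ Ω ℓ) : Bundle Ω := ⟨0, le_rfl, hΩ⟩

/-- Agents `i` and `j` have Euclidean preferences with peaks `p` and `q`, the others want
nothing. -/
noncomputable def twoAgentProfile (hΩ : ∀ ℓ, 0 ≤ Ω ℓ) (i j : Fin n) (p q : Bundle Ω) :
    Fin n → multidimSinglePeaked Ω := fun a =>
  euclideanReport (if a = i then p else if a = j then q else zeroBundle hΩ)

lemma twoAgentProfile_swap (hΩ : ∀ ℓ, 0 ≤ Ω ℓ) {i j : Fin n} (hij : i ≠ j) (p q : Bundle Ω) :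
    twoAgentProfile hΩ j i q p = twoAgentProfile hΩ i j p q := by
  funext a
  unfold twoAgentProfile
  congr 1
  split_ifs <;> simp_all

lemma update_twoAgentProfile (hΩ : ∀ ℓ, 0 ≤ Ω ℓ) (i j : Fin n) (p p' q : Bundle Ω) :
    Function.update (twoAgentProfile hΩ i j p q) i (euclideanReport p') =
      twoAgentProfile hΩ i j p' q := by
  funext a
  by_cases h : a = i
  · subst h; simp [twoAgentProfile]
  · simp [twoAgentProfile, h]

lemma exists_mem_segment_dist_le {E : Type*} [NormedAddCommGroup E] [NormedSpace ℝ E]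
    {p c : E} {a b : ℝ} (ha : 0 ≤ a) (hb : 0 ≤ b) (h : dist p c ≤ a + b) :
    ∃ z ∈ segment ℝ p c, dist z p ≤ a ∧ dist z c ≤ b ∧ dist z p + dist z c = dist p c := by
  rcases le_or_gt (dist p c) a with hL | hL
  · exact ⟨c, right_mem_segment _ _ _, by rwa [dist_comm], by simpa using hb,
      by simp [dist_comm]⟩
  · have hpos : 0 < dist p c := ha.trans_lt hL
    have hmem : a / dist p c ∈ Set.Icc (0 : ℝ) 1 :=
      ⟨by positivity, (div_le_one hpos).2 hL.le⟩
    have h1 : dist (AffineMap.lineMap p c (a / dist p c)) p = a := by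
      rw [dist_lineMap_left, Real.norm_of_nonneg hmem.1]; field_simp
    have h2 : dist (AffineMap.lineMap p c (a / dist p c)) c = dist p c - a := by
      rw [dist_lineMap_right, Real.norm_of_nonneg (by linarith [hmem.2])]; field_simp
    refine ⟨AffineMap.lineMap p c (a / dist p c), ?_, h1.le, by linarith, by linarith⟩
    rw [segment_eq_image_lineMap]
    exact ⟨_, hmem, rfl⟩

/-- When the two active agents jointly want at least the endowment, efficiency gives the
endowment to them and puts the first one on the segment between the two peaks. -/
lemma Rule.Efficient.twoAgentProfile {φ : Rule n (multidimSinglePeaked Ω)}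
    (hφ : Rule.Efficient φ) (hΩ : ∀ ℓ, 0 ≤ Ω ℓ) {i j : Fin n} (hij : i ≠ j) {p q : Bundle Ω}
    (hpq : ∀ ℓ, Ω ℓ ≤ p.1 ℓ + q.1 ℓ) :
    let x := (φ (twoAgentProfile hΩ i j p q)).1
    (x j).vec = WithLp.toLp 2 Ω - (x i).vec ∧
      dist (x i).vec p.vec + dist (x j).vec q.vec = dist p.vec (WithLp.toLp 2 Ω - q.vec) := by
  intro x
  have hsum : ∑ a, (x a).1 = Ω := (φ (_root_.twoAgentProfile hΩ i j p q)).2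
  have hle : ∀ ℓ, (x i).1 ℓ + (x j).1 ℓ ≤ Ω ℓ := fun ℓ => by
    rw [← congrFun hsum ℓ, Finset.sum_apply, ← Finset.sum_pair (f := fun a => (x a).1 ℓ) hij]
    exact Finset.sum_le_sum_of_subset_of_nonneg (Finset.subset_univ _)
      fun a _ _ => (x a).2.1 ℓ
  have htri : dist p.vec (WithLp.toLp 2 Ω - q.vec) ≤
      dist (x i).vec p.vec + dist (x j).vec q.vec := by
    -- Coordinatewise p + q ≥ Ω ≥ x i + x j, so Ω is the closer of the two totals to p + q.
    calc dist p.vec (WithLp.toLp 2 Ω - q.vec)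
        ≤ dist (p.vec + q.vec) ((x i).vec + (x j).vec) := by
          rw [EuclideanSpace.dist_eq, EuclideanSpace.dist_eq]
          refine Real.sqrt_le_sqrt (Finset.sum_le_sum fun ℓ _ => ?_)
          simp only [Real.dist_eq, sq_abs, Bundle.vec_apply, PiLp.sub_apply, PiLp.add_apply]
          nlinarith [hle ℓ, hpq ℓ]
      _ ≤ dist p.vec (x i).vec + dist q.vec (x j).vec := dist_add_add_le _ _ _ _
      _ = _ := by rw [dist_comm p.vec, dist_comm q.vec]
  obtain ⟨z, hz, hzp, hzc, hzs⟩ := exists_mem_segment_dist_le dist_nonneg dist_nonneg htri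
  have hzbox : ∀ ℓ, 0 ≤ z ℓ ∧ z ℓ ≤ Ω ℓ := by
    obtain ⟨s, t, hs, ht, hst, rfl⟩ := hz
    intro ℓ
    have hp := p.2; have hq := q.2
    have h1 := hp.1 ℓ; have h2 := hp.2 ℓ; have h3 := hq.1 ℓ; have h4 := hq.2 ℓ
    obtain rfl : s = 1 - t := by linarith
    simp only [PiLp.add_apply, PiLp.smul_apply, PiLp.sub_apply, smul_eq_mul, Bundle.vec_apply]
    simp only [Pi.zero_apply] at h1 h3
    constructor <;> nlinarith
  let zi : Bundle Ω := ⟨z.ofLp, fun ℓ => (hzbox ℓ).1, fun ℓ => (hzbox ℓ).2⟩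
  let zj : Bundle Ω := ⟨Ω - z.ofLp, fun ℓ => sub_nonneg.2 (hzbox ℓ).2,
    fun ℓ => sub_le_self _ (hzbox ℓ).1⟩
  have hzi : zi.vec = z := rfl
  have hzj : dist zj.vec q.vec = dist z (WithLp.toLp 2 Ω - q.vec) := by
    have : zj.vec = WithLp.toLp 2 Ω - z := rfl
    rw [this, dist_eq_norm, dist_eq_norm, ← norm_neg]
    congr 1; abel
  let w : Fin n → Bundle Ω := fun a => if a = i then zi else if a = j then zj else zeroBundle hΩ
  have hwi : w i = zi := by simp [w]
  have hwj : w j = zj := by simp [w, hij.symm]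
  have hw0 : ∀ a, a ≠ i → a ≠ j → w a = zeroBundle hΩ := fun a h h' => by simp [w, h, h']
  have hwsum : ∑ a, (w a).1 = Ω := by
    rw [Finset.sum_eq_add i j hij (fun a _ h => by rw [hw0 a h.1 h.2]; rfl)
      (by simp) (by simp), hwi, hwj]
    simp [zi, zj]
  have hR : ∀ a (y : Bundle Ω) (y' : Bundle Ω),
      ((_root_.twoAgentProfile hΩ i j p q) a).1.rel y y' ↔
        dist y.vec (if a = i then p else if a = j then q else zeroBundle hΩ).vec ≤
        dist y'.vec (if a = i then p else if a = j then q else zeroBundle hΩ).vec :=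
    fun a y y' => Iff.rfl
  have hweak : ∀ a, ((_root_.twoAgentProfile hΩ i j p q) a).1.rel (w a) (x a) := by
    intro a
    rw [hR]
    by_cases h : a = i
    · subst h; rw [hwi, if_pos rfl]; exact hzp
    by_cases h' : a = j
    · subst h'; rw [hwj, if_neg h, if_pos rfl, hzj]; exact hzc
    · rw [hw0 a h h', if_neg h, if_neg h', dist_self]; exact dist_nonneg
  -- `w` is feasible and weakly better for everyone, so efficiency makes everyone indifferent. The
  -- inactive agents then sit at their peak, zero.
  have hback : ∀ a, ((_root_.twoAgentProfile hΩ i j p q) a).1.rel (x a) (w a) := by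
    intro a
    by_contra h
    exact hφ _ ⟨⟨w, hwsum⟩, hweak, a, hweak a, h⟩
  have hx0 : ∀ a, a ≠ i → a ≠ j → x a = zeroBundle hΩ := by
    intro a h h'
    have := hback a
    rw [hR, hw0 a h h', if_neg h, if_neg h', dist_self] at this
    exact Bundle.vec_injective (dist_le_zero.1 this)
  have hbi : dist (x i).vec p.vec ≤ dist z p.vec := by
    have := hback i
    rwa [hR, hwi, if_pos rfl] at this
  have hbj : dist (x j).vec q.vec ≤ dist z (WithLp.toLp 2 Ω - q.vec) := by
    have := hback j
    rwa [hR, hwj, if_neg hij.symm, if_pos rfl, hzj] at this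
  refine ⟨?_, le_antisymm (by linarith) htri⟩
  rw [Finset.sum_eq_add i j hij (fun a _ h => by rw [hx0 a h.1 h.2]; rfl)
      (by simp) (by simp)] at hsum
  rw [eq_sub_iff_add_eq, add_comm]
  exact congrArg (WithLp.toLp 2) hsum

end TwoActiveAgents

/-! ### Strategy-proofness on a sector of peaks -/

section MenusOnSegments

/-- A function on an interval with quadratically small increments is constant. -/
lemma eq_of_abs_sub_le_mul_sq {f : ℝ → ℝ} {a b C : ℝ}
    (h : ∀ s ∈ Set.Icc a b, ∀ t ∈ Set.Icc a b, |f s - f t| ≤ C * (s - t) ^ 2)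
    {s t : ℝ} (hs : s ∈ Set.Icc a b) (ht : t ∈ Set.Icc a b) : f s = f t := by
  have hder : ∀ u ∈ Set.Icc a b, HasDerivWithinAt f 0 (Set.Icc a b) u := by
    intro u hu
    rw [hasDerivWithinAt_iff_isLittleO]
    have h1 : (fun v => f v - f u - (v - u) • (0 : ℝ)) =O[nhdsWithin u (Set.Icc a b)]
        fun v => (v - u) ^ 2 := by
      refine Asymptotics.IsBigO.of_bound C ?_
      filter_upwards [self_mem_nhdsWithin] with v hv
      simpa using h v hv u hu
    refine h1.trans_isLittleO ?_
    have h2 : (fun v : ℝ => (v - u) ^ 2) =o[nhds u] fun v => v - u := by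
      have := (Asymptotics.isLittleO_pow_id (𝕜 := ℝ) (n := 2) one_lt_two).comp_tendsto
        (show Filter.Tendsto (fun v : ℝ => v - u) (nhds u) (nhds 0) by
          simpa using (continuous_sub_right u).tendsto u)
      exact this
    exact h2.mono nhdsWithin_le_nhds
  have := (convex_Icc a b).norm_image_sub_le_of_norm_hasDerivWithin_le (C := 0) hder
    (fun _ _ => by simp) ht hs
  simpa [sub_eq_zero] using this

variable {E : Type*} [NormedAddCommGroup E] [InnerProductSpace ℝ E]

/-- The unit vector at angle `t` in the plane of `u` and `v`. -/
noncomputable def planeUnit (u v : E) (t : ℝ) : E := Real.cos t • u + Real.sin t • v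

lemma inner_planeUnit {u v : E} (hu : ‖u‖ = 1) (hv : ‖v‖ = 1) (huv : ⟪u, v⟫ = 0) (s t : ℝ) :
    ⟪planeUnit u v s, planeUnit u v t⟫ = Real.cos (s - t) := by
  have hvu : ⟪v, u⟫ = 0 := by rw [real_inner_comm]; exact huv
  simp only [planeUnit, inner_add_left, inner_add_right, real_inner_smul_left,
    real_inner_smul_right, real_inner_self_eq_norm_sq, hu, hv, huv, hvu, Real.cos_sub]
  ring

lemma norm_planeUnit {u v : E} (hu : ‖u‖ = 1) (hv : ‖v‖ = 1) (huv : ⟪u, v⟫ = 0) (t : ℝ) :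
    ‖planeUnit u v t‖ = 1 := by
  have := inner_planeUnit hu hv huv t t
  rw [real_inner_self_eq_norm_sq, sub_self, Real.cos_zero] at this
  nlinarith [norm_nonneg (planeUnit u v t)]

/-- The law of cosines, arranged to separate the radial from the angular contribution. -/
lemma norm_smul_planeUnit_sub_sq {u v : E} (hu : ‖u‖ = 1) (hv : ‖v‖ = 1) (huv : ⟪u, v⟫ = 0)
    (a b s t : ℝ) : ‖a • planeUnit u v s - b • planeUnit u v t‖ ^ 2 =
      (a - b) ^ 2 + 2 * (a * b) * (1 - Real.cos (s - t)) := by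
  rw [norm_sub_sq_real, real_inner_smul_left, real_inner_smul_right, inner_planeUnit hu hv huv,
    norm_smul, norm_smul, norm_planeUnit hu hv huv, norm_planeUnit hu hv huv, mul_one, mul_one,
    Real.norm_eq_abs, Real.norm_eq_abs, sq_abs, sq_abs]
  ring

/-- Suppose that an agent with Euclidean preferences, for each peak in a sector with apex `c`,
receives a bundle on the segment between the peak and `c`, never gaining from misreporting. If at
some peak of the sector the bundle is half-way between that peak and `c`, then its distance to `c`
is the same at all peaks whose distance to `c` is slightly smaller. -/
lemma dist_apex_eq_of_nonmanipulable {u v c : E} (hu : ‖u‖ = 1) (hv : ‖v‖ = 1)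
    (huv : ⟪u, v⟫ = 0) {a b ρ L t₀ t₁ : ℝ} (f : ℝ → ℝ → E)
    (hseg : ∀ s ∈ Set.Icc 0 (2 * ρ), ∀ t ∈ Set.Icc a b,
      dist (f s t) (c + s • planeUnit u v t) + dist (f s t) c = s)
    (hsp : ∀ s ∈ Set.Icc 0 (2 * ρ), ∀ t ∈ Set.Icc a b, ∀ s' ∈ Set.Icc 0 (2 * ρ),
      ∀ t' ∈ Set.Icc a b, dist (f s t) (c + s • planeUnit u v t) ≤
        dist (f s' t') (c + s • planeUnit u v t))
    (ht₀ : t₀ ∈ Set.Icc a b) (ht₁ : t₁ ∈ Set.Icc a b)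
    (hhalf : dist (f (2 * ρ) t₀) c = ρ) (hL : 3 * ρ < 2 * L) (hL' : L ≤ 2 * ρ) :
    dist (f L t₁) c = ρ := by
  have hρ : 0 ≤ ρ := hhalf ▸ dist_nonneg
  have hLmem : L ∈ Set.Icc 0 (2 * ρ) := ⟨by linarith, hL'⟩
  have hρmem : 2 * ρ ∈ Set.Icc 0 (2 * ρ) := ⟨by linarith, le_rfl⟩
  let r : ℝ → ℝ → ℝ := fun s t => dist (f s t) c
  have hr0 : ∀ s t, 0 ≤ r s t := fun _ _ => dist_nonneg
  have hdist : ∀ s ∈ Set.Icc 0 (2 * ρ), ∀ t ∈ Set.Icc a b,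
      dist (f s t) (c + s • planeUnit u v t) = s - r s t := fun s hs t ht => by
    have := hseg s hs t ht
    simp only [r]; linarith
  have hrs : ∀ s ∈ Set.Icc 0 (2 * ρ), ∀ t ∈ Set.Icc a b, r s t ≤ s := fun s hs t ht => by
    have := hdist s hs t ht
    linarith [dist_nonneg (x := f s t) (y := c + s • planeUnit u v t)]
  have hf : ∀ s ∈ Set.Icc 0 (2 * ρ), ∀ t ∈ Set.Icc a b,
      f s t = c + r s t • planeUnit u v t := by
    intro s hs t ht
    have hn : dist c (c + s • planeUnit u v t) = s := by
      rw [dist_self_add_right, norm_smul, norm_planeUnit hu hv huv, mul_one,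
        Real.norm_of_nonneg hs.1]
    -- Equality in the triangle inequality puts the bundle on the segment, so its distance to the
    -- apex determines it.
    have hw : Wbtw ℝ c (f s t) (c + s • planeUnit u v t) := by
      rw [← dist_add_dist_eq_iff, hn, dist_comm c, hdist s hs t ht]
      simp only [r]; ring
    obtain ⟨τ, hτ, hτf⟩ := hw
    have hτ' : f s t = c + (τ * s) • planeUnit u v t := by
      rw [← hτf, AffineMap.lineMap_apply, vsub_eq_sub, vadd_eq_add, add_sub_cancel_left,
        smul_smul, add_comm]
    have : r s t = τ * s := by
      simp only [r]
      rw [hτ', dist_self_add_left, norm_smul, norm_planeUnit hu hv huv, mul_one,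
        Real.norm_of_nonneg (mul_nonneg hτ.1 hs.1)]
    rw [this, hτ']
  have hsq : ∀ s ∈ Set.Icc 0 (2 * ρ), ∀ t ∈ Set.Icc a b, ∀ s' ∈ Set.Icc 0 (2 * ρ),
      ∀ t' ∈ Set.Icc a b, (s - r s t) ^ 2 ≤
        (s - r s' t') ^ 2 + 2 * (s * r s' t') * (1 - Real.cos (t - t')) := by
    intro s hs t ht s' hs' t' ht'
    rw [← norm_smul_planeUnit_sub_sq hu hv huv, ← hdist s hs t ht]
    refine pow_le_pow_left₀ dist_nonneg ((hsp s hs t ht s' hs' t' ht').trans_eq ?_) 2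
    rw [hf s' hs' t' ht', dist_add_left, dist_comm, dist_eq_norm]
  -- On the ray at angle t₀, peak L must not gain by reporting 2ρ, which gives r ≥ ρ, nor peak 2ρ by
  -- reporting L, which gives r ≤ ρ.
  have hradial : r L t₀ = ρ := by
    have h1 := hsq L hLmem t₀ ht₀ (2 * ρ) hρmem t₀ ht₀
    have h2 := hsq (2 * ρ) hρmem t₀ ht₀ L hLmem t₀ ht₀
    have h3 : r (2 * ρ) t₀ = ρ := hhalf
    have h4 := hrs L hLmem t₀ ht₀
    simp only [h3, sub_self, Real.cos_zero, mul_zero, add_zero] at h1 h2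
    have h5 := sq_le_sq.1 h1
    have h6 := sq_le_sq.1 h2
    rw [abs_of_nonneg (by linarith : 0 ≤ L - r L t₀), abs_of_nonneg (by linarith : 0 ≤ L - ρ)] at h5
    rw [abs_of_nonneg (by linarith : 0 ≤ 2 * ρ - ρ),
      abs_of_nonneg (by linarith : 0 ≤ 2 * ρ - r L t₀)] at h6
    linarith
  -- The angular term is second order: 1 - cos x ≤ x²/2 and r ≤ L.
  have hstep : ∀ s ∈ Set.Icc a b, ∀ t ∈ Set.Icc a b,
      (L - r L s) ^ 2 - (L - r L t) ^ 2 ≤ L ^ 2 * (s - t) ^ 2 := by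
    intro s hs t ht
    have h1 := hsq L hLmem s hs L hLmem t ht
    have h2 := Real.one_sub_sq_div_two_le_cos (x := s - t)
    have h3 : L * r L t * (2 * (1 - Real.cos (s - t))) ≤ L ^ 2 * (s - t) ^ 2 := by
      refine mul_le_mul ?_ (by linarith) (by linarith [Real.cos_le_one (s - t)]) (sq_nonneg L)
      nlinarith [hrs L hLmem t ht, hLmem.1]
    linarith
  have hconst : (L - r L t₁) ^ 2 = (L - r L t₀) ^ 2 := by
    refine eq_of_abs_sub_le_mul_sq (f := fun t => (L - r L t) ^ 2) (C := L ^ 2) ?_ ht₁ ht₀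
    intro s hs t ht
    refine abs_sub_le_iff.2 ⟨hstep s hs t ht, ?_⟩
    have := hstep t ht s hs
    linarith [congrArg (fun y => L ^ 2 * y) (by ring : (t - s) ^ 2 = (s - t) ^ 2)]
  have := (sq_eq_sq₀ (by linarith [hrs L hLmem t₁ ht₁]) (by linarith [hrs L hLmem t₀ ht₀])).1 hconst
  change r L t₁ = ρ
  linarith

end MenusOnSegments

/-! ### The sector of peaks inside the consumption set -/

section Impossibility

variable {l n : ℕ} {Ω : Fin l → ℝ}

/-- Equal division of the endowment between two agents. -/
noncomputable def halfVec (Ω : Fin l → ℝ) : EuclideanSpace ℝ (Fin l) := (2⁻¹ : ℝ) • WithLp.toLp 2 Ω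

lemma inner_single_single_of_ne {k m : Fin l} (hkm : k ≠ m) :
    ⟪EuclideanSpace.single k (1 : ℝ), EuclideanSpace.single m (1 : ℝ)⟫ = 0 := by
  rw [EuclideanSpace.inner_single_left]
  simp [hkm]

lemma abs_planeUnit_single_apply_le {k m : Fin l} (hkm : k ≠ m) (t : ℝ) (ℓ : Fin l) :
    |planeUnit (EuclideanSpace.single k (1 : ℝ)) (EuclideanSpace.single m 1) t ℓ| ≤ 1 := by
  by_cases hk : ℓ = k
  · subst hk
    simpa [planeUnit, hkm] using Real.abs_cos_le_one t
  by_cases hm : ℓ = m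
  · subst hm
    simpa [planeUnit, hk] using Real.abs_sin_le_one t
  · simp [planeUnit, hk, hm]

lemma planeUnit_single_apply_eq_zero {k m ℓ : Fin l} (hk : ℓ ≠ k) (hm : ℓ ≠ m) (t : ℝ) :
    planeUnit (EuclideanSpace.single k (1 : ℝ)) (EuclideanSpace.single m 1) t ℓ = 0 := by
  simp [planeUnit, hk, hm]

lemma planeUnit_single_apply_nonneg {k m : Fin l} {t : ℝ}
    (ht : t ∈ Set.Icc 0 (Real.pi / 2)) (ℓ : Fin l) :
    0 ≤ planeUnit (EuclideanSpace.single k (1 : ℝ)) (EuclideanSpace.single m 1) t ℓ := by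
  have hc := Real.cos_nonneg_of_mem_Icc ⟨by linarith [ht.1, ht.2], ht.2⟩
  have hs := Real.sin_nonneg_of_nonneg_of_le_pi ht.1 (by linarith [ht.1, ht.2])
  simp only [planeUnit, PiLp.add_apply, PiLp.smul_apply, PiLp.single_apply, smul_eq_mul]
  split_ifs <;> simp <;> linarith

/-- In goods k and m the point is within ρ + 2ρ = 3ρ of Ω/2, which 6ρ ≤ Ω allows; the other goods
stay at Ω/2. -/
lemma exists_bundle_vec_eq {k m : Fin l} (hkm : k ≠ m) (hΩ : ∀ ℓ, 0 ≤ Ω ℓ) {ρ : ℝ}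
    (hk : 6 * ρ ≤ Ω k) (hm : 6 * ρ ≤ Ω m) {α s t : ℝ} (hρ : 0 ≤ ρ) (hs : s ∈ Set.Icc 0 (2 * ρ)) :
    ∃ p : Bundle Ω, p.vec = halfVec Ω -
      ρ • planeUnit (EuclideanSpace.single k (1 : ℝ)) (EuclideanSpace.single m 1) α +
      s • planeUnit (EuclideanSpace.single k (1 : ℝ)) (EuclideanSpace.single m 1) t := by
  set e := planeUnit (EuclideanSpace.single k (1 : ℝ)) (EuclideanSpace.single m 1) with he
  have hbox : ∀ ℓ, 0 ≤ (halfVec Ω - ρ • e α + s • e t) ℓ ∧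
      (halfVec Ω - ρ • e α + s • e t) ℓ ≤ Ω ℓ := by
    intro ℓ
    have h0 := hΩ ℓ
    have hval : (halfVec Ω - ρ • e α + s • e t) ℓ = 2⁻¹ * Ω ℓ - ρ * e α ℓ + s * e t ℓ := by
      simp [halfVec]
    rw [hval]
    by_cases h : ℓ = k ∨ ℓ = m
    · have h6 : 6 * ρ ≤ Ω ℓ := by rcases h with rfl | rfl <;> assumption
      have h1 : |ρ * e α ℓ| ≤ ρ * 1 := by
        rw [abs_mul, abs_of_nonneg hρ]
        exact mul_le_mul_of_nonneg_left (abs_planeUnit_single_apply_le hkm α ℓ) hρ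
      have h2 : |s * e t ℓ| ≤ 2 * ρ * 1 := by
        rw [abs_mul, abs_of_nonneg hs.1]
        exact mul_le_mul hs.2 (abs_planeUnit_single_apply_le hkm t ℓ) (abs_nonneg _) (by linarith)
      rw [abs_le] at h1 h2
      constructor <;> linarith [h1.1, h1.2, h2.1, h2.2]
    · push Not at h
      rw [he, planeUnit_single_apply_eq_zero h.1 h.2, planeUnit_single_apply_eq_zero h.1 h.2]
      constructor <;> linarith
  exact ⟨⟨(halfVec Ω - ρ • e α + s • e t).ofLp, fun ℓ => (hbox ℓ).1, fun ℓ => (hbox ℓ).2⟩, rfl⟩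

/-- The agent whose peak lies at angle `α` on the circle around equal division receives a bundle at
distance `ρ` from it if the peak of the other active agent is at angle `2 * t₁ - α`. -/
lemma dist_peak_eq {φ : Rule n (multidimSinglePeaked Ω)} (hsp : Rule.StrategyProof φ)
    (heff : Rule.Efficient φ) (het : Rule.EqualTreatment φ) (hΩ : ∀ ℓ, 0 ≤ Ω ℓ)
    {i j : Fin n} (hij : i ≠ j) {k m : Fin l} (hkm : k ≠ m) {ρ L α t₁ : ℝ} (hρ : 0 ≤ ρ)
    (hk : 6 * ρ ≤ Ω k) (hm : 6 * ρ ≤ Ω m) (hα : α ∈ Set.Icc 0 (Real.pi / 2))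
    (ht₁ : t₁ ∈ Set.Icc 0 (Real.pi / 2)) (hL : 3 * ρ < 2 * L) (hL' : L ≤ 2 * ρ) {p q : Bundle Ω}
    (hq : q.vec = halfVec Ω +
      ρ • planeUnit (EuclideanSpace.single k (1 : ℝ)) (EuclideanSpace.single m 1) α)
    (hp : p.vec = WithLp.toLp 2 Ω - q.vec +
      L • planeUnit (EuclideanSpace.single k (1 : ℝ)) (EuclideanSpace.single m 1) t₁) :
    dist ((φ (twoAgentProfile hΩ i j p q)).1 j).vec q.vec = ρ := by
  have hu : ‖EuclideanSpace.single k (1 : ℝ)‖ = 1 := by simp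
  have hv : ‖EuclideanSpace.single m (1 : ℝ)‖ = 1 := by simp
  have huv : ⟪EuclideanSpace.single k (1 : ℝ), EuclideanSpace.single m (1 : ℝ)⟫ = 0 :=
    inner_single_single_of_ne hkm
  set e := planeUnit (EuclideanSpace.single k (1 : ℝ)) (EuclideanSpace.single m 1) with he
  set c : EuclideanSpace ℝ (Fin l) := WithLp.toLp 2 Ω - q.vec with hc
  have hc' : c = halfVec Ω - ρ • e α := by
    have : WithLp.toLp 2 Ω = halfVec Ω + halfVec Ω := by
      rw [halfVec, ← add_smul]; norm_num
    rw [hc, hq, this]; abel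
  -- Outside the range of s the peak may leave the box; any default bundle will do there.
  have hex : ∀ s t, ∃ p' : Bundle Ω, s ∈ Set.Icc 0 (2 * ρ) → p'.vec = c + s • e t := by
    intro s t
    by_cases hs : s ∈ Set.Icc 0 (2 * ρ)
    · obtain ⟨p', hp'⟩ := exists_bundle_vec_eq (α := α) (t := t) hkm hΩ hk hm hρ hs
      exact ⟨p', fun _ => by rw [hp', hc']⟩
    · exact ⟨zeroBundle hΩ, fun h => absurd h hs⟩
  choose P hP using hex
  let f : ℝ → ℝ → EuclideanSpace ℝ (Fin l) := fun s t =>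
    ((φ (twoAgentProfile hΩ i j (P s t) q)).1 i).vec
  have hE : ∀ s ∈ Set.Icc 0 (2 * ρ), ∀ t ∈ Set.Icc 0 (Real.pi / 2),
      ((φ (twoAgentProfile hΩ i j (P s t) q)).1 j).vec = WithLp.toLp 2 Ω - f s t ∧
      dist (f s t) (c + s • e t) +
        dist ((φ (twoAgentProfile hΩ i j (P s t) q)).1 j).vec q.vec = s := by
    intro s hs t ht
    -- Angles in the first quadrant keep the displacement from c nonnegative.
    have hfeas : ∀ ℓ, Ω ℓ ≤ (P s t).1 ℓ + q.1 ℓ := by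
      intro ℓ
      have h1 : (P s t).1 ℓ = Ω ℓ - q.1 ℓ + s * e t ℓ := by
        rw [← Bundle.vec_apply, hP s t hs]; rfl
      have h2 := mul_nonneg hs.1 (planeUnit_single_apply_nonneg (k := k) (m := m) ht ℓ)
      rw [← he] at h2
      linarith
    have h := heff.twoAgentProfile hΩ hij hfeas
    refine ⟨h.1, ?_⟩
    have h2 := h.2
    rwa [hP s t hs, ← hc, dist_self_add_left, norm_smul, norm_planeUnit hu hv huv, mul_one,
      Real.norm_of_nonneg hs.1] at h2
  have hcdist : ∀ s ∈ Set.Icc 0 (2 * ρ), ∀ t ∈ Set.Icc 0 (Real.pi / 2),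
      dist ((φ (twoAgentProfile hΩ i j (P s t) q)).1 j).vec q.vec = dist (f s t) c := by
    intro s hs t ht
    rw [(hE s hs t ht).1, hc, dist_eq_norm, dist_eq_norm, ← norm_neg]
    congr 1; abel
  have hLmem : L ∈ Set.Icc 0 (2 * ρ) := ⟨by linarith, hL'⟩
  have hρmem : 2 * ρ ∈ Set.Icc 0 (2 * ρ) := ⟨by linarith, le_rfl⟩
  have hPp : P L t₁ = p := Bundle.vec_injective (by rw [hP L t₁ hLmem, hp])
  -- Since c and q are opposite across Ω/2, the peak at s = 2ρ, t = α is q itself, and equal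
  -- treatment applies.
  have hPq : P (2 * ρ) α = q := Bundle.vec_injective (by
    rw [hP _ α hρmem, hc', hq, two_mul, add_smul]; abel)
  have hhalf : dist (f (2 * ρ) α) c = ρ := by
    have h1 := (hE _ hρmem α hα).2
    have h2 := hcdist _ hρmem α hα
    have h3 := het (twoAgentProfile hΩ i j q q) i j
      (by simp [twoAgentProfile])
    have h4 : ((twoAgentProfile hΩ i j q q) i).1 = euclideanPreference q := by
      simp [twoAgentProfile, euclideanReport]
    rw [h4] at h3
    have h5 := le_antisymm (euclideanPreference_rel.1 h3.1) (euclideanPreference_rel.1 h3.2)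
    rw [← hP _ α hρmem] at h1
    simp only [f, hPq] at h1 h2 ⊢
    linarith
  have := dist_apex_eq_of_nonmanipulable hu hv huv (c := c) (a := 0) (b := Real.pi / 2)
    (t₁ := t₁) f
    (fun s hs t ht => by rw [← hcdist s hs t ht]; exact (hE s hs t ht).2)
    (fun s hs t ht s' hs' t' ht' => by
      have h := hsp (twoAgentProfile hΩ i j (P s t) q) i (euclideanReport (P s' t'))
      have h4 : ((twoAgentProfile hΩ i j (P s t) q) i).1 = euclideanPreference (P s t) := by
        simp [twoAgentProfile, euclideanReport]
      rw [update_twoAgentProfile, h4, euclideanPreference_rel, hP s t hs] at h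
      exact h)
    hα ht₁ hhalf hL hL'
  rwa [← hcdist L hLmem t₁ ht₁, hPp] at this

end Impossibility

/-- The diagonal of the rhombus spanned by two unit vectors at angle π/3; its length √3 lies between
3/2 and 2, as the choice of L requires. -/
lemma planeUnit_zero_add_planeUnit_pi_div_three {E : Type*} [NormedAddCommGroup E]
    [InnerProductSpace ℝ E] (u v : E) :
    planeUnit u v 0 + planeUnit u v (Real.pi / 3) = √3 • planeUnit u v (Real.pi / 6) := by
  have h3 : √3 * √3 = (3 : ℝ) := Real.mul_self_sqrt (by norm_num)
  simp only [planeUnit, Real.cos_zero, Real.sin_zero, Real.cos_pi_div_three,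
    Real.sin_pi_div_three, Real.cos_pi_div_six, Real.sin_pi_div_six, smul_add, smul_smul]
  rw [show √3 * (√3 / 2) = 1 + 1 / 2 by linarith]
  module

theorem lemma1 {n l : ℕ} (hn : 2 ≤ n) (Ω : Fin l → ℝ) (hΩ : ∀ ℓ, 0 ≤ Ω ℓ)
    (hpos : ∃ k m : Fin l, k ≠ m ∧ 0 < Ω k ∧ 0 < Ω m) :
    ¬ ∃ φ : Rule n (multidimSinglePeaked Ω),
      Rule.StrategyProof φ ∧ Rule.Efficient φ ∧ Rule.EqualTreatment φ := by
  rintro ⟨φ, hsp, heff, het⟩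
  obtain ⟨k, m, hkm, hk, hm⟩ := hpos
  obtain ⟨ρ, hρ, hρk, hρm⟩ : ∃ ρ : ℝ, 0 < ρ ∧ 6 * ρ ≤ Ω k ∧ 6 * ρ ≤ Ω m :=
    ⟨min (Ω k) (Ω m) / 6, by positivity, by linarith [min_le_left (Ω k) (Ω m)],
      by linarith [min_le_right (Ω k) (Ω m)]⟩
  let i : Fin n := ⟨0, by omega⟩
  let j : Fin n := ⟨1, by omega⟩
  have hij : i ≠ j := by simp [i, j]
  set e := planeUnit (EuclideanSpace.single k (1 : ℝ)) (EuclideanSpace.single m 1) with he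
  have hpeak : ∀ t, ∃ p : Bundle Ω, p.vec = halfVec Ω + ρ • e t := fun t => by
    obtain ⟨p, hp⟩ := exists_bundle_vec_eq (α := t) (t := t) (s := 2 * ρ) hkm hΩ hρk hρm hρ.le
      ⟨by linarith, le_rfl⟩
    exact ⟨p, by rw [hp, two_mul, add_smul]; abel⟩
  obtain ⟨q, hq⟩ := hpeak 0
  obtain ⟨p, hp⟩ := hpeak (Real.pi / 3)
  have hπ := Real.pi_pos
  have hsum : p.vec + q.vec = WithLp.toLp 2 Ω + (√3 * ρ) • e (Real.pi / 6) := by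
    have h2 : WithLp.toLp 2 Ω = halfVec Ω + halfVec Ω := by
      rw [halfVec, ← add_smul]; norm_num
    rw [mul_comm, ← smul_smul, ← planeUnit_zero_add_planeUnit_pi_div_three, hp, hq, h2, smul_add]
    abel
  have hs3 : √3 * √3 = (3 : ℝ) := Real.mul_self_sqrt (by norm_num)
  have hs0 := Real.sqrt_nonneg 3
  have hs1 : 3 < 2 * √3 := by nlinarith
  have hs2 : √3 < 2 := by nlinarith
  have hL : 3 * ρ < 2 * (√3 * ρ) := by nlinarith
  have hL' : √3 * ρ < 2 * ρ := by nlinarith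
  have h6 : Real.pi / 6 ∈ Set.Icc 0 (Real.pi / 2) := ⟨by linarith, by linarith⟩
  have hpc : p.vec = WithLp.toLp 2 Ω - q.vec + (√3 * ρ) • e (Real.pi / 6) := by
    rw [eq_sub_of_add_eq hsum]; abel
  have hqc : q.vec = WithLp.toLp 2 Ω - p.vec + (√3 * ρ) • e (Real.pi / 6) := by
    rw [eq_sub_of_add_eq' hsum]; abel
  have hdj := dist_peak_eq hsp heff het hΩ hij hkm hρ.le hρk hρm ⟨le_rfl, by linarith⟩ h6 hL hL'.le
    hq hpc
  -- The same bound with the agents' roles exchanged: p is now the fixed peak.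
  have hdi := dist_peak_eq hsp heff het hΩ hij.symm hkm hρ.le hρk hρm
    ⟨by linarith, by linarith⟩ h6 hL hL'.le hp hqc
  rw [twoAgentProfile_swap hΩ hij] at hdi
  have hfeas : ∀ ℓ, Ω ℓ ≤ p.1 ℓ + q.1 ℓ := by
    intro ℓ
    have h1 : p.1 ℓ + q.1 ℓ = Ω ℓ + √3 * ρ * e (Real.pi / 6) ℓ := congrArg (fun y => y ℓ) hsum
    have h2 := mul_nonneg (mul_nonneg hs0 hρ.le)
      (planeUnit_single_apply_nonneg (k := k) (m := m) h6 ℓ)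
    rw [← he] at h2
    linarith
  have htot := (heff.twoAgentProfile hΩ hij hfeas).2
  rw [hdi, hdj, hpc, dist_self_add_left, norm_smul,
    norm_planeUnit (by simp) (by simp) (inner_single_single_of_ne hkm), mul_one,
    Real.norm_of_nonneg (mul_nonneg hs0 hρ.le)] at htot
  linarith
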